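/- Let $B=(B_t)_{t\ge 0}$ be a standard real Brownian motion (with almost surely continuous paths) which starts from $x\in\mathbb{R}$ at time $0$ under the law $\mathbb{P}_x$, and let $\mathbb{E}_x$ be the expectation under $\mathbb{P}_x$. For an event $A$ and a random variable $X$ write $\mathbb{E}_x[X;A]=\mathbb{E}_x[X\mathbf{1}_A]$. There exists a unique convex function $\Psi:\mathbb{R}\to\mathbb{R}$ such that for all $h\in\mathbb{R}$ $$\lim_{t\to+\infty}\frac1t\log\sup_{x\in[0,1]}\mathbb{E}_x\left[e^{-h\int_0^t B_s\,ds};\ B_s\in[0,1]\text{ for all } s\in[0,t]\right]=\Psi(h).$$ The function $\Psi$ does not depend on the choice of the probability space, the laws $\mathbb{P}_x$ and the Brownian motion $B$. -/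

import Mathlib

open MeasureTheory ProbabilityTheory Filter Topology
open scoped NNReal

/-- `B` is a standard real Brownian motion that starts from `x` at time `0` under the law `P x`:
for each `x`, the process `B - x` is a standard Brownian motion (started from `0`) under `P x`. -/
def IsBrownianFamily {Ω : Type*} [MeasurableSpace Ω] (P : ℝ → Measure Ω) (B : ℝ≥0 → Ω → ℝ) :
    Prop :=
  ∀ x : ℝ, IsBrownianReal (fun t ω => B t ω - x) (P x)

/-- The expectation `E_μ[exp(-h ∫₀ᵗ B_s ds); B_s ∈ [0,1] for all s ∈ [0,t]]`: the integral is taken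
over the event that the path stays in `[0,1]` up to time `t`. -/
noncomputable def confinedLaplace {Ω : Type*} [MeasurableSpace Ω] (μ : Measure Ω)
    (B : ℝ≥0 → Ω → ℝ) (h : ℝ) (t : ℝ≥0) : ℝ :=
  ∫ ω in {ω | ∀ s : ℝ≥0, s ≤ t → B s ω ∈ Set.Icc (0 : ℝ) 1},
    Real.exp (-h * ∫ s in (0 : ℝ)..(t : ℝ), B s.toNNReal ω) ∂μ

/-- For every real `h`, the quantity
`(1/t) log sup_{x ∈ [0,1]} E_x[exp(-h ∫₀ᵗ B_s ds); B_s ∈ [0,1], s ∈ [0,t]]`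
converges to `Ψ h` as `t → +∞`. -/
def IsConfinedRate {Ω : Type*} [MeasurableSpace Ω] (P : ℝ → Measure Ω) (B : ℝ≥0 → Ω → ℝ)
    (Ψ : ℝ → ℝ) : Prop :=
  ∀ h : ℝ, Tendsto
    (fun t : ℝ≥0 =>
      (1 / (t : ℝ)) * Real.log (⨆ x : Set.Icc (0 : ℝ) 1, confinedLaplace (P x) B h t))
    atTop (𝓝 (Ψ h))

/-!
# The growth rate of Brownian motion confined to `[0,1]`

Write `Z_h(t, x)` for the expectation of `exp (-h ∫₀ᵗ B)` over the paths from `x` that stay in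
`[0,1]` up to time `t`, and `U_h(t) = sup_x Z_h(t, x)` over `x ∈ [0,1]`. The Markov property at time
`s` writes `Z_h(s + t, x)` as an expectation of the weight up to time `s` times `Z_h(t, B_s)`
(`meanWeight_add`). As `B_s ∈ [0,1]` wherever the weight is not `0`, `U_h` is submultiplicative
(`supWeight_add_le`), so that `log U_h` is subadditive and Fekete's lemma gives the limit.

Two bounds keep the limit finite. On confined paths `|∫₀ᵗ B| ≤ t`, so `U_h(t)` is at most
`exp (|h| t)` and at least `exp (-|h| t)` times the probability of confinement. This probability
decays at most exponentially (`exists_pow_le_meanWeight_zero`): by path continuity there is a short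
time during which the path moves by at most `1/4` with probability at least `3/4`, and by symmetry
the increment over this time points from `x ∈ [1/4, 3/4]` towards `1/2` with probability at least
`1/2`. Hence with probability at least `1/4` the path stays in `[0,1]` and ends in `[1/4, 3/4]`, and
this step can be iterated.

Hölder's inequality makes `Z_h(t, x)` log-convex in `h` (`meanWeight_convexComb_le`). This passes to
the supremum and to the limit.

A Brownian motion is only assumed to be a.e. measurable at each time and a.s. continuous. For
measurability, for the Markov property and for the independence of the probability space, the weight
is therefore written as a measurable function `ratWeight` of the path at nonnegative rational times,
which agrees with `pathWeight` on continuous paths. The law of a Brownian motion at these times is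
determined by its finite-dimensional laws (`map_rat_eq`).
-/

open Set
open scoped ENNReal

namespace ConfinedBrownian

/-! ### Path functionals -/

open Classical in
/-- The weight `exp (-h ∫₀ᵗ p) 1{p ∈ [0,1] on [0,t]}` of a path `p` in continuous time. -/
noncomputable def pathWeight (h : ℝ) (t : ℝ≥0) (p : ℝ≥0 → ℝ) : ℝ≥0∞ :=
  if ∀ s ≤ t, p s ∈ Icc (0 : ℝ) 1 then
    ENNReal.ofReal (Real.exp (-h * ∫ s in (0 : ℝ)..t, p s.toNNReal))
  else 0

/-- The integral `∫₀ᵗ w` of a path known at rational times only, as the `limsup` of the integrals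
of the step functions `s ↦ w (⌊n s⌋ / n)`. This makes it a measurable function of `w`. -/
noncomputable def ratArea (t : ℝ≥0) (w : ℚ≥0 → ℝ) : ℝ :=
  limsup (fun n : ℕ => ∫ s in (0 : ℝ)..t, w ((⌊(n : ℝ) * s⌋₊ : ℚ≥0) / n)) atTop

open Classical in
/-- The counterpart of `pathWeight` for a path known at rational times only. -/
noncomputable def ratWeight (h : ℝ) (t : ℝ≥0) (w : ℚ≥0 → ℝ) : ℝ≥0∞ :=
  if ∀ q : ℚ≥0, (q : ℝ≥0) ≤ t → w q ∈ Icc (0 : ℝ) 1 then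
    ENNReal.ofReal (Real.exp (-h * ratArea t w))
  else 0

lemma measurable_ratArea (t : ℝ≥0) : Measurable (ratArea t) := by
  refine Measurable.limsup fun n => ?_
  have hm : Measurable fun z : (ℚ≥0 → ℝ) × ℝ => z.1 ((⌊(n : ℝ) * z.2⌋₊ : ℚ≥0) / n) := by
    have h1 : Measurable fun z : (ℚ≥0 → ℝ) × ℕ => z.1 ((z.2 : ℚ≥0) / n) :=
      measurable_from_prod_countable_left fun k =>
        measurable_pi_apply ((k : ℚ≥0) / n)
    exact h1.comp (measurable_fst.prodMk
      (Nat.measurable_floor.comp (measurable_const.mul measurable_snd)))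
  simp_rw [intervalIntegral.integral_of_le t.coe_nonneg]
  exact hm.stronglyMeasurable.integral_prod_right.measurable

lemma measurable_ratWeight (h : ℝ) (t : ℝ≥0) : Measurable (ratWeight h t) := by
  have : Measurable fun w => ENNReal.ofReal (Real.exp (-h * ratArea t w)) := by
    have := measurable_ratArea t
    fun_prop
  refine this.ite ?_ measurable_const
  simp only [ofPred_forall]
  exact .iInter fun q => .iInter fun _ => measurable_pi_apply q measurableSet_Icc

lemma ratArea_congr {t : ℝ≥0} {w w' : ℚ≥0 → ℝ} (hw : ∀ q : ℚ≥0, (q : ℝ≥0) ≤ t → w q = w' q) :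
    ratArea t w = ratArea t w' := by
  unfold ratArea
  congr 1
  ext n
  refine intervalIntegral.integral_congr fun s hs => hw _ ?_
  rw [uIcc_of_le t.coe_nonneg] at hs
  rw [← NNReal.coe_le_coe]
  push_cast
  rcases Nat.eq_zero_or_pos n with rfl | hn
  · simp
  · have hn' : (0 : ℝ) < n := by exact_mod_cast hn
    rw [div_le_iff₀ hn']
    calc (⌊(n : ℝ) * s⌋₊ : ℝ) ≤ n * s := Nat.floor_le (mul_nonneg hn'.le hs.1)
      _ ≤ t * n := by rw [mul_comm]; exact mul_le_mul_of_nonneg_right hs.2 hn'.le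

open Classical in
lemma ratWeight_congr (h : ℝ) {t : ℝ≥0} {w w' : ℚ≥0 → ℝ}
    (hw : ∀ q : ℚ≥0, (q : ℝ≥0) ≤ t → w q = w' q) : ratWeight h t w = ratWeight h t w' := by
  have hmem : (∀ q : ℚ≥0, (q : ℝ≥0) ≤ t → w q ∈ Icc (0 : ℝ) 1) ↔
      ∀ q : ℚ≥0, (q : ℝ≥0) ≤ t → w' q ∈ Icc (0 : ℝ) 1 :=
    forall₂_congr fun q hq => by rw [hw q hq]
  simp only [ratWeight, ratArea_congr hw]
  exact if_congr hmem rfl rfl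

/-- A continuous path that is in a closed set at the rational times up to `t` is in it at all times
up to `t`, also if `t` is irrational or `0`. -/
lemma forall_mem_of_forall_rat {p : ℝ≥0 → ℝ} (hp : Continuous p) {C : Set ℝ} (hC : IsClosed C)
    {t : ℝ≥0} (hq : ∀ q : ℚ≥0, (q : ℝ≥0) ≤ t → p q ∈ C) : ∀ s ≤ t, p s ∈ C := by
  rcases eq_or_ne t 0 with rfl | ht
  · intro s hs
    obtain rfl : s = 0 := le_antisymm hs zero_le
    simpa using hq 0 (by simp)
  have hd : Iio t ⊆ closure (range (fun q : ℚ≥0 => (q : ℝ≥0)) ∩ Iio t) := by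
    intro s hs
    rw [mem_closure_iff]
    intro o ho hso
    obtain ⟨u, hu, hsub⟩ := exists_Ico_subset_of_mem_nhds (ho.mem_nhds hso) ⟨t, hs⟩
    obtain ⟨q, hq1, hq2⟩ := exists_rat_btwn (NNReal.coe_lt_coe.2 (lt_min hu hs))
    have hq0 : 0 ≤ q := by
      have : (0 : ℝ) ≤ q := s.2.trans hq1.le
      exact_mod_cast this
    lift q to ℚ≥0 using hq0
    have hq1' : s < (q : ℝ≥0) := by rw [← NNReal.coe_lt_coe]; exact_mod_cast hq1
    have hq2' : (q : ℝ≥0) < min u t := by rw [← NNReal.coe_lt_coe]; exact_mod_cast hq2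
    exact ⟨q, hsub ⟨hq1'.le, hq2'.trans_le (min_le_left _ _)⟩, ⟨q, rfl⟩,
      hq2'.trans_le (min_le_right _ _)⟩
  have hsub : Iic t ⊆ closure (range (fun q : ℚ≥0 => (q : ℝ≥0)) ∩ Iio t) := by
    rw [← closure_Iio' ⟨0, pos_iff_ne_zero.2 ht⟩]
    exact closure_minimal hd isClosed_closure
  intro s hs
  refine closure_minimal ?_ (hC.preimage hp) (hsub hs)
  rintro _ ⟨⟨q, rfl⟩, hqt⟩
  exact hq q (le_of_lt hqt)

lemma ratArea_of_continuous {p : ℝ≥0 → ℝ} (hp : Continuous p) (t : ℝ≥0) :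
    ratArea t (fun q => p q) = ∫ s in (0 : ℝ)..t, p s.toNNReal := by
  refine Tendsto.limsup_eq ?_
  obtain ⟨C, hC⟩ := (isCompact_Icc (a := (0 : ℝ≥0)) (b := t)).exists_bound_of_continuousOn
    hp.continuousOn
  have key : ∀ (n : ℕ) (s : ℝ), (((⌊(n : ℝ) * s⌋₊ : ℚ≥0) / n : ℚ≥0) : ℝ≥0) =
      (⌊(n : ℝ) * s⌋₊ : ℝ≥0) / n := fun n s => by push_cast; rfl
  simp_rw [key]
  refine intervalIntegral.tendsto_integral_filter_of_dominated_convergence (fun _ => C) ?_ ?_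
    intervalIntegrable_const ?_
  · refine .of_forall fun n => Measurable.aestronglyMeasurable ?_
    exact hp.measurable.comp ((measurable_from_nat (f := fun k : ℕ => (k : ℝ≥0) / n)).comp
      (Nat.measurable_floor.comp (measurable_const.mul measurable_id)))
  · refine .of_forall fun n => .of_forall fun s hs => hC _ ⟨zero_le, ?_⟩
    rw [uIoc_of_le t.coe_nonneg] at hs
    rw [← NNReal.coe_le_coe]
    push_cast
    rcases Nat.eq_zero_or_pos n with rfl | hn
    · simp
    · have hn' : (0 : ℝ) < n := by exact_mod_cast hn
      rw [div_le_iff₀ hn']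
      calc (⌊(n : ℝ) * s⌋₊ : ℝ) ≤ n * s := Nat.floor_le (mul_nonneg hn'.le hs.1.le)
        _ ≤ t * n := by rw [mul_comm]; exact mul_le_mul_of_nonneg_right hs.2 hn'.le
  · refine .of_forall fun s hs => ?_
    rw [uIoc_of_le t.coe_nonneg] at hs
    refine (hp.tendsto _).comp ?_
    rw [← NNReal.tendsto_coe]
    have := (tendsto_nat_floor_mul_div_atTop (R := ℝ) hs.1.le).comp tendsto_natCast_atTop_atTop
    rw [Real.coe_toNNReal s hs.1.le]
    refine this.congr fun n => ?_
    simp [mul_comm]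

open Classical in
lemma ratWeight_of_continuous (h : ℝ) (t : ℝ≥0) {p : ℝ≥0 → ℝ} (hp : Continuous p) :
    ratWeight h t (fun q => p q) = pathWeight h t p := by
  have : (∀ q : ℚ≥0, (q : ℝ≥0) ≤ t → p q ∈ Icc (0 : ℝ) 1) ↔ ∀ s ≤ t, p s ∈ Icc (0 : ℝ) 1 :=
    ⟨fun hq => forall_mem_of_forall_rat hp isClosed_Icc hq, fun hs q hq => hs _ hq⟩
  simp only [ratWeight, pathWeight, ratArea_of_continuous hp]
  exact if_congr this rfl rfl

lemma pathWeight_add (h : ℝ) (s t : ℝ≥0) {p : ℝ≥0 → ℝ} (hp : Continuous p) :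
    pathWeight h (s + t) p = pathWeight h s p * pathWeight h t (fun r => p (s + r)) := by
  have hiff : (∀ r ≤ s + t, p r ∈ Icc (0 : ℝ) 1) ↔
      (∀ r ≤ s, p r ∈ Icc (0 : ℝ) 1) ∧ ∀ r ≤ t, p (s + r) ∈ Icc (0 : ℝ) 1 := by
    refine ⟨fun H => ⟨fun r hr => H r (hr.trans le_self_add), fun r hr => H _ (by gcongr)⟩,
      fun ⟨H1, H2⟩ r hr => ?_⟩
    rcases le_total r s with hrs | hrs
    · exact H1 r hrs
    · obtain ⟨u, rfl⟩ := exists_add_of_le hrs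
      exact H2 u (le_of_add_le_add_left hr)
  have hc : Continuous fun r : ℝ => p r.toNNReal := by fun_prop
  have hint : ∫ r in (0 : ℝ)..(s + t : ℝ≥0), p r.toNNReal =
      (∫ r in (0 : ℝ)..s, p r.toNNReal) + ∫ r in (0 : ℝ)..t, p (s + r.toNNReal) := by
    rw [← intervalIntegral.integral_add_adjacent_intervals (b := (s : ℝ))
      (hc.intervalIntegrable _ _) (hc.intervalIntegrable _ _)]
    congr 1
    have h1 : ∫ r in (0 : ℝ)..t, p (s + r.toNNReal) =
        ∫ r in (0 : ℝ)..t, p (s + r : ℝ).toNNReal := by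
      refine intervalIntegral.integral_congr fun r hr => ?_
      rw [uIcc_of_le t.coe_nonneg] at hr
      simp only [Real.toNNReal_add s.coe_nonneg hr.1, Real.toNNReal_coe]
    rw [h1, intervalIntegral.integral_comp_add_left (fun r => p r.toNNReal)]
    simp
  by_cases h1 : ∀ r ≤ s, p r ∈ Icc (0 : ℝ) 1
  · by_cases h2 : ∀ r ≤ t, p (s + r) ∈ Icc (0 : ℝ) 1
    · have h3 := hiff.2 ⟨h1, h2⟩
      rw [pathWeight, pathWeight, pathWeight, if_pos h3, if_pos h1, if_pos h2,
        ← ENNReal.ofReal_mul (by positivity), ← Real.exp_add, hint]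
      ring_nf
    · rw [pathWeight, if_neg fun H => h2 (hiff.1 H).2, pathWeight, pathWeight, if_neg h2, mul_zero]
  · rw [pathWeight, if_neg fun H => h1 (hiff.1 H).1, pathWeight, if_neg h1, zero_mul]

lemma mem_of_pathWeight_ne_zero {h : ℝ} {t : ℝ≥0} {p : ℝ≥0 → ℝ} (hp : pathWeight h t p ≠ 0) :
    ∀ s ≤ t, p s ∈ Icc (0 : ℝ) 1 :=
  by_contra fun h => hp (if_neg h)

lemma pathWeight_of_mem (h : ℝ) {t : ℝ≥0} {p : ℝ≥0 → ℝ} (hp : ∀ s ≤ t, p s ∈ Icc (0 : ℝ) 1) :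
    pathWeight h t p = ENNReal.ofReal (Real.exp (-h * ∫ s in (0 : ℝ)..t, p s.toNNReal)) :=
  if_pos hp

lemma abs_area_le {t : ℝ≥0} {p : ℝ≥0 → ℝ} (hp : ∀ s ≤ t, p s ∈ Icc (0 : ℝ) 1) :
    |∫ s in (0 : ℝ)..t, p s.toNNReal| ≤ t := by
  have := intervalIntegral.norm_integral_le_of_norm_le_const (a := (0 : ℝ)) (b := t) (C := 1)
    (f := fun s => p s.toNNReal) fun s hs => by
      rw [uIoc_of_le t.coe_nonneg] at hs
      have := hp s.toNNReal (Real.toNNReal_le_iff_le_coe.2 hs.2)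
      rw [Real.norm_eq_abs, abs_le]
      exact ⟨by linarith [this.1], this.2⟩
  simpa using this

lemma pathWeight_le (h : ℝ) (t : ℝ≥0) (p : ℝ≥0 → ℝ) :
    pathWeight h t p ≤ ENNReal.ofReal (Real.exp (|h| * t)) := by
  by_cases hp : ∀ s ≤ t, p s ∈ Icc (0 : ℝ) 1
  · rw [pathWeight_of_mem h hp]
    refine ENNReal.ofReal_le_ofReal (Real.exp_le_exp.2 ?_)
    calc -h * ∫ s in (0 : ℝ)..t, p s.toNNReal ≤ |-h * ∫ s in (0 : ℝ)..t, p s.toNNReal| :=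
          le_abs_self _
      _ ≤ |h| * t := by
          rw [abs_mul, abs_neg]
          exact mul_le_mul_of_nonneg_left (abs_area_le hp) (abs_nonneg h)
  · rw [pathWeight, if_neg hp]
    exact zero_le

lemma exp_mul_pathWeight_zero_le (h : ℝ) (t : ℝ≥0) (p : ℝ≥0 → ℝ) :
    ENNReal.ofReal (Real.exp (-|h| * t)) * pathWeight 0 t p ≤ pathWeight h t p := by
  by_cases hp : ∀ s ≤ t, p s ∈ Icc (0 : ℝ) 1
  · rw [pathWeight_of_mem h hp, pathWeight_of_mem 0 hp]
    simp only [neg_zero, zero_mul, Real.exp_zero, ENNReal.ofReal_one, mul_one]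
    refine ENNReal.ofReal_le_ofReal (Real.exp_le_exp.2 ?_)
    calc -|h| * t ≤ -|-h * ∫ s in (0 : ℝ)..t, p s.toNNReal| := by
          rw [abs_mul, abs_neg, neg_mul]
          exact neg_le_neg (mul_le_mul_of_nonneg_left (abs_area_le hp) (abs_nonneg h))
      _ ≤ -h * ∫ s in (0 : ℝ)..t, p s.toNNReal := neg_abs_le _
  · rw [pathWeight, if_neg hp, mul_zero]
    exact zero_le

lemma pathWeight_convexComb (a b h k : ℝ) (t : ℝ≥0) (p : ℝ≥0 → ℝ) :
    pathWeight (a * h + b * k) t p ≤ pathWeight h t p ^ a * pathWeight k t p ^ b := by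
  by_cases hp : ∀ s ≤ t, p s ∈ Icc (0 : ℝ) 1
  · rw [pathWeight_of_mem _ hp, pathWeight_of_mem _ hp, pathWeight_of_mem _ hp,
      ENNReal.ofReal_rpow_of_pos (by positivity), ENNReal.ofReal_rpow_of_pos (by positivity),
      ← ENNReal.ofReal_mul (by positivity), ← Real.exp_mul, ← Real.exp_mul, ← Real.exp_add]
    refine le_of_eq ?_
    congr 2
    ring
  · rw [pathWeight, if_neg hp]
    exact zero_le

/-! ### The law of Brownian motion at rational times and the Markov property -/

variable {Ω Ω' : Type*} [MeasurableSpace Ω] [MeasurableSpace Ω'] {P : Measure Ω} {P' : Measure Ω'}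
  {W : ℝ≥0 → Ω → ℝ} {W' : ℝ≥0 → Ω' → ℝ}

lemma aemeasurable_rat (hW : IsPreBrownianReal W P) :
    AEMeasurable (fun ω (q : ℚ≥0) => W q ω) P :=
  aemeasurable_pi_lambda _ fun q => hW.aemeasurable q

/-- The law of a Brownian motion at rational times is unique. The restriction to countably many
times makes the path an a.e. measurable function of `ω`, which the whole path need not be. -/
lemma map_rat_eq (hW : IsPreBrownianReal W P) (hW' : IsPreBrownianReal W' P') :
    P.map (fun ω (q : ℚ≥0) => W q ω) = P'.map (fun ω (q : ℚ≥0) => W' q ω) := by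
  have hP := hW.isGaussianProcess.isProbabilityMeasure
  have hP' := hW'.isGaussianProcess.isProbabilityMeasure
  have h1 := isProjectiveLimit_map (aemeasurable_rat hW)
  have h2 := isProjectiveLimit_map (aemeasurable_rat hW')
  have key : ∀ I : Finset ℚ≥0, P.map (fun ω => I.restrict fun q : ℚ≥0 => W q ω) =
      P'.map (fun ω => I.restrict fun q : ℚ≥0 => W' q ω) := by
    intro I
    let J : Finset ℝ≥0 := I.image (fun q : ℚ≥0 => (q : ℝ≥0))
    let g : (J → ℝ) → (I → ℝ) := fun v i => v ⟨(i : ℚ≥0), Finset.mem_image_of_mem _ i.2⟩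
    have hg : Measurable g := measurable_pi_lambda _ fun i => measurable_pi_apply _
    have e1 := AEMeasurable.map_map_of_aemeasurable (μ := P) hg.aemeasurable
      (hW.hasLaw J).aemeasurable
    have e2 := AEMeasurable.map_map_of_aemeasurable (μ := P') hg.aemeasurable
      (hW'.hasLaw J).aemeasurable
    rw [(hW.hasLaw J).map_eq] at e1
    rw [(hW'.hasLaw J).map_eq] at e2
    exact e1.symm.trans e2
  simp_rw [key] at h1
  have : ∀ I : Finset ℚ≥0,
      IsFiniteMeasure (P'.map (fun ω => I.restrict fun q : ℚ≥0 => W' q ω)) :=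
    fun I => inferInstance
  exact h1.unique h2

lemma lintegral_rat_eq (hW : IsPreBrownianReal W P) (hW' : IsPreBrownianReal W' P')
    {g : (ℚ≥0 → ℝ) → ℝ≥0∞} (hg : Measurable g) :
    ∫⁻ ω, g (fun q => W q ω) ∂P = ∫⁻ ω, g (fun q => W' q ω) ∂P' := by
  rw [← lintegral_map' hg.aemeasurable (aemeasurable_rat hW), map_rat_eq hW hW',
    lintegral_map' hg.aemeasurable (aemeasurable_rat hW')]

/-- The **Markov property** at time `t` of a Brownian motion started from `x`, for a functional `f`
of the path up to time `t` and a functional `g` of the path after time `t`. -/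
lemma lintegral_mul_shift (hW : IsPreBrownianReal W P) (t : ℝ≥0) (x : ℝ)
    {f g : (ℚ≥0 → ℝ) → ℝ≥0∞} (hf : Measurable f) (hg : Measurable g)
    (hft : ∀ w w' : ℚ≥0 → ℝ, (∀ q : ℚ≥0, (q : ℝ≥0) ≤ t → w q = w' q) → f w = f w') :
    ∫⁻ ω, f (fun q => x + W q ω) * g (fun q => x + W (t + q) ω) ∂P =
      ∫⁻ ω, f (fun q => x + W q ω) * ∫⁻ ω', g (fun q => x + W t ω + W q ω') ∂P ∂P := by
  classical
  have hP := hW.isGaussianProcess.isProbabilityMeasure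
  let past : Ω → ({q : ℚ≥0 // (q : ℝ≥0) ≤ t} → ℝ) × ℝ := fun ω => (fun q => W q.1 ω, W t ω)
  let future : Ω → ℚ≥0 → ℝ := fun ω q => W (t + q) ω - W t ω
  -- the path up to time `t`, continued by zero
  let ext : ({q : ℚ≥0 // (q : ℝ≥0) ≤ t} → ℝ) → ℚ≥0 → ℝ :=
    fun a q => x + if hq : (q : ℝ≥0) ≤ t then a ⟨q, hq⟩ else 0
  have hext : Measurable ext := by
    refine measurable_pi_lambda _ fun q => measurable_const.add ?_
    by_cases hq : (q : ℝ≥0) ≤ t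
    · simp only [hq, dite_true]; exact measurable_pi_apply _
    · simp only [hq, dite_false]; exact measurable_const
  have hf_ext : ∀ ω, f (fun q => x + W q ω) = f (ext (past ω).1) := fun ω =>
    hft _ _ fun q hq => by simp [ext, past, hq]
  have hind : IndepFun past future P := by
    have h0 := (hW.indepFun_shift t).symm
    have hφ : Measurable fun a : Iic t → ℝ =>
        ((fun q => a ⟨q.1, q.2⟩, a ⟨t, self_mem_Iic⟩) : ({q : ℚ≥0 // (q : ℝ≥0) ≤ t} → ℝ) × ℝ) :=
      (measurable_pi_lambda _ fun q => measurable_pi_apply _).prodMk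
        (measurable_pi_apply (⟨t, self_mem_Iic⟩ : Iic t))
    have hψ : Measurable fun (a : ℝ≥0 → ℝ) (q : ℚ≥0) => a q :=
      measurable_pi_lambda _ fun q => measurable_pi_apply _
    exact h0.comp hφ hψ
  have hpast : AEMeasurable past P :=
    (aemeasurable_pi_lambda _ fun q => hW.aemeasurable _).prodMk (hW.aemeasurable t)
  have hfuture : AEMeasurable future P := aemeasurable_rat (hW.shift t)
  have hG : Measurable fun z : (({q : ℚ≥0 // (q : ℝ≥0) ≤ t} → ℝ) × ℝ) × (ℚ≥0 → ℝ) =>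
      g (fun q => x + z.1.2 + z.2 q) := hg.comp (by fun_prop)
  have hF : Measurable fun z : (({q : ℚ≥0 // (q : ℝ≥0) ≤ t} → ℝ) × ℝ) × (ℚ≥0 → ℝ) =>
      f (ext z.1.1) * g (fun q => x + z.1.2 + z.2 q) :=
    (hf.comp (hext.comp (measurable_fst.comp measurable_fst))).mul hG
  have hR : Measurable fun z : ({q : ℚ≥0 // (q : ℝ≥0) ≤ t} → ℝ) × ℝ =>
      f (ext z.1) * ∫⁻ c, g (fun q => x + z.2 + c q) ∂(P.map future) :=
    (hf.comp (hext.comp measurable_fst)).mul hG.lintegral_prod_right'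
  calc ∫⁻ ω, f (fun q => x + W q ω) * g (fun q => x + W (t + q) ω) ∂P
      = ∫⁻ ω, f (ext (past ω).1) * g (fun q => x + (past ω).2 + future ω q) ∂P := by
        refine lintegral_congr fun ω => ?_
        rw [hf_ext]
        congr 2
        ext q
        simp [past, future]
    _ = ∫⁻ z, f (ext z.1.1) * g (fun q => x + z.1.2 + z.2 q) ∂(P.map fun ω => (past ω, future ω)) :=
        (lintegral_map' hF.aemeasurable (hpast.prodMk hfuture)).symm
    _ = ∫⁻ z, f (ext z.1) * ∫⁻ c, g (fun q => x + z.2 + c q) ∂(P.map future) ∂(P.map past) := by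
        rw [hind.map_prod_eq_prod_map_map hpast hfuture, lintegral_prod _ hF.aemeasurable]
        refine lintegral_congr fun z => ?_
        have hz : Measurable fun c : ℚ≥0 → ℝ => g (fun q => x + z.2 + c q) := hg.comp (by fun_prop)
        exact lintegral_const_mul (f (ext z.1)) hz
    _ = ∫⁻ ω, f (ext (past ω).1) * ∫⁻ c, g (fun q => x + (past ω).2 + c q) ∂(P.map future) ∂P :=
        lintegral_map' hR.aemeasurable hpast
    _ = _ := by
        refine lintegral_congr fun ω => ?_
        rw [hf_ext]
        have hg' : Measurable fun c : ℚ≥0 → ℝ => g (fun q => x + W t ω + c q) :=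
          hg.comp (by fun_prop)
        have e1 : P.map future = P.map (fun ω (q : ℚ≥0) => W q ω) := map_rat_eq (hW.shift t) hW
        rw [e1, lintegral_map' hg'.aemeasurable (aemeasurable_rat hW)]

/-! ### The confined partition function -/

/-- The mean of `pathWeight h t` over the paths of `x + W`. -/
noncomputable def meanWeight (P : Measure Ω) (W : ℝ≥0 → Ω → ℝ) (h : ℝ) (t : ℝ≥0) (x : ℝ) : ℝ≥0∞ :=
  ∫⁻ ω, pathWeight h t (fun s => x + W s ω) ∂P

/-- The supremum of `meanWeight` over the starting points in `[0,1]`. -/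
noncomputable def supWeight (P : Measure Ω) (W : ℝ≥0 → Ω → ℝ) (h : ℝ) (t : ℝ≥0) : ℝ≥0∞ :=
  ⨆ x : Icc (0 : ℝ) 1, meanWeight P W h t x

lemma ratWeight_ae_eq (hW : IsBrownianReal W P) (h : ℝ) (t : ℝ≥0) (x : ℝ) :
    (fun ω => ratWeight h t fun q => x + W q ω) =ᵐ[P]
      fun ω => pathWeight h t fun s => x + W s ω := by
  filter_upwards [hW.cont] with ω hω
  exact ratWeight_of_continuous h t (continuous_const.add hω)

lemma aemeasurable_pathWeight (hW : IsBrownianReal W P) (h : ℝ) (t : ℝ≥0) (x : ℝ) :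
    AEMeasurable (fun ω => pathWeight h t fun s => x + W s ω) P := by
  refine AEMeasurable.congr ?_ (ratWeight_ae_eq hW h t x)
  exact (measurable_ratWeight h t).comp_aemeasurable
    (aemeasurable_pi_lambda _ fun q => (hW.aemeasurable q).const_add x)

lemma meanWeight_eq_lintegral_ratWeight (hW : IsBrownianReal W P) (h : ℝ) (t : ℝ≥0) (x : ℝ) :
    meanWeight P W h t x = ∫⁻ ω, ratWeight h t (fun q => x + W q ω) ∂P :=
  (lintegral_congr_ae (ratWeight_ae_eq hW h t x)).symm

/-- The partition function depends on the law of the Brownian motion only. -/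
lemma meanWeight_eq (hW : IsBrownianReal W P) (hW' : IsBrownianReal W' P') :
    meanWeight P W = meanWeight P' W' := by
  ext h t x
  rw [meanWeight_eq_lintegral_ratWeight hW, meanWeight_eq_lintegral_ratWeight hW']
  have hg : Measurable fun w : ℚ≥0 → ℝ => ratWeight h t fun q => x + w q :=
    (measurable_ratWeight h t).comp (by fun_prop)
  exact lintegral_rat_eq hW.toIsPreBrownianReal hW'.toIsPreBrownianReal hg

lemma measurable_meanWeight (hW : IsBrownianReal W P) (h : ℝ) (t : ℝ≥0) :
    Measurable (meanWeight P W h t) := by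
  have hP := hW.isGaussianProcess.isProbabilityMeasure
  have hg : Measurable fun z : ℝ × (ℚ≥0 → ℝ) => ratWeight h t fun q => z.1 + z.2 q :=
    (measurable_ratWeight h t).comp (by fun_prop)
  have e : meanWeight P W h t = fun x =>
      ∫⁻ w, ratWeight h t (fun q => x + w q) ∂(P.map fun ω (q : ℚ≥0) => W q ω) := by
    ext x
    have hx : Measurable fun w : ℚ≥0 → ℝ => ratWeight h t fun q => x + w q :=
      (measurable_ratWeight h t).comp (by fun_prop)
    rw [meanWeight_eq_lintegral_ratWeight hW,
      lintegral_map' hx.aemeasurable (aemeasurable_rat hW.toIsPreBrownianReal)]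
  rw [e]
  exact hg.lintegral_prod_right'

lemma meanWeight_le [IsProbabilityMeasure P] (h : ℝ) (t : ℝ≥0) (x : ℝ) :
    meanWeight P W h t x ≤ ENNReal.ofReal (Real.exp (|h| * t)) :=
  (lintegral_mono fun _ => pathWeight_le h t _).trans (by simp)

lemma supWeight_le [IsProbabilityMeasure P] (h : ℝ) (t : ℝ≥0) :
    supWeight P W h t ≤ ENNReal.ofReal (Real.exp (|h| * t)) :=
  iSup_le fun x => meanWeight_le h t x

lemma supWeight_ne_top [IsProbabilityMeasure P] (h : ℝ) (t : ℝ≥0) : supWeight P W h t ≠ ∞ :=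
  ((supWeight_le h t).trans_lt ENNReal.ofReal_lt_top).ne

/-- The Markov property of the partition function. -/
lemma meanWeight_add (hW : IsBrownianReal W P) (h : ℝ) (s t : ℝ≥0) (x : ℝ) :
    meanWeight P W h (s + t) x =
      ∫⁻ ω, pathWeight h s (fun r => x + W r ω) * meanWeight P W h t (x + W s ω) ∂P := by
  have hm := lintegral_mul_shift hW.toIsPreBrownianReal s x (measurable_ratWeight h s)
    (measurable_ratWeight h t) fun _ _ hw => ratWeight_congr h hw
  simp_rw [meanWeight_eq_lintegral_ratWeight hW h t]
  refine Eq.trans ?_ (hm.trans (lintegral_congr_ae ?_))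
  · refine lintegral_congr_ae ?_
    filter_upwards [hW.cont] with ω hω
    have hω' : Continuous fun r => x + W r ω := continuous_const.add hω
    rw [pathWeight_add h s t hω', ratWeight_of_continuous h s hω',
      ratWeight_of_continuous h t (p := fun r => x + W (s + r) ω)
        (hω'.comp (continuous_const.add continuous_id))]
  · filter_upwards [ratWeight_ae_eq hW h s x] with ω hω
    rw [hω]

/-- Submultiplicativity in time. -/
lemma supWeight_add_le (hW : IsBrownianReal W P) (h : ℝ) (s t : ℝ≥0) :
    supWeight P W h (s + t) ≤ supWeight P W h s * supWeight P W h t := by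
  refine iSup_le fun x => ?_
  have hbound : meanWeight P W h (s + t) x ≤ meanWeight P W h s x * supWeight P W h t := by
    rw [meanWeight_add hW, meanWeight,
      ← lintegral_mul_const'' _ (aemeasurable_pathWeight hW h s x)]
    refine lintegral_mono fun ω => ?_
    by_cases h0 : pathWeight h s (fun r => (x : ℝ) + W r ω) = 0
    · simp [h0]
    · -- a path of nonzero weight is in `[0,1]` at time `s`, where the later weight is evaluated
      exact mul_le_mul_right (le_iSup (fun y : Icc (0 : ℝ) 1 => meanWeight P W h t y)
        ⟨_, mem_of_pathWeight_ne_zero h0 s le_rfl⟩) _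
  exact hbound.trans (mul_le_mul_left (le_iSup (fun y : Icc (0 : ℝ) 1 => meanWeight P W h s y) x) _)

lemma exp_mul_meanWeight_zero_le (h : ℝ) (t : ℝ≥0) (x : ℝ) :
    ENNReal.ofReal (Real.exp (-|h| * t)) * meanWeight P W 0 t x ≤ meanWeight P W h t x := by
  rw [meanWeight, ← lintegral_const_mul' _ _ ENNReal.ofReal_ne_top]
  exact lintegral_mono fun ω => exp_mul_pathWeight_zero_le h t _

/-- Hölder's inequality: the partition function is log-convex in `h`. -/
lemma meanWeight_convexComb_le (hW : IsBrownianReal W P) {a b : ℝ} (ha : 0 ≤ a) (hb : 0 ≤ b)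
    (hab : a + b = 1) (h k : ℝ) (t : ℝ≥0) (x : ℝ) :
    meanWeight P W (a * h + b * k) t x ≤ meanWeight P W h t x ^ a * meanWeight P W k t x ^ b :=
  (lintegral_mono fun _ => pathWeight_convexComb a b h k t _).trans
    (ENNReal.lintegral_mul_norm_pow_le (aemeasurable_pathWeight hW h t x)
      (aemeasurable_pathWeight hW k t x) ha hb hab)

lemma supWeight_convexComb_le (hW : IsBrownianReal W P) {a b : ℝ} (ha : 0 ≤ a) (hb : 0 ≤ b)
    (hab : a + b = 1) (h k : ℝ) (t : ℝ≥0) :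
    supWeight P W (a * h + b * k) t ≤ supWeight P W h t ^ a * supWeight P W k t ^ b := by
  refine iSup_le fun x => (meanWeight_convexComb_le hW ha hb hab h k t x).trans ?_
  exact mul_le_mul'
    (ENNReal.rpow_le_rpow (le_iSup (fun y : Icc (0 : ℝ) 1 => meanWeight P W h t y) x) ha)
    (ENNReal.rpow_le_rpow (le_iSup (fun y : Icc (0 : ℝ) 1 => meanWeight P W k t y) x) hb)

/-! ### The confinement probability decays at most exponentially -/

lemma half_le_measure_nonneg (hW : IsPreBrownianReal W P) (t : ℝ≥0) :
    1 / 2 ≤ P {ω | 0 ≤ W t ω} := by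
  have hP := hW.isGaussianProcess.isProbabilityMeasure
  have h1 : P {ω | 0 ≤ W t ω} = P {ω | W t ω ≤ 0} := by
    have e1 : P {ω | 0 ≤ W t ω} = gaussianReal 0 t (Ici 0) := by
      rw [← (hW.hasLaw_eval t).map_eq, Measure.map_apply_of_aemeasurable (hW.aemeasurable t)
        measurableSet_Ici]
      rfl
    have e2 : P {ω | W t ω ≤ 0} = gaussianReal 0 t (Ici 0) := by
      rw [← (hW.neg.hasLaw_eval t).map_eq, Measure.map_apply_of_aemeasurable
        (hW.neg.aemeasurable t) measurableSet_Ici]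
      congr 1
      ext ω
      simp
    rw [e1, e2]
  have h2 : 1 ≤ P {ω | 0 ≤ W t ω} + P {ω | W t ω ≤ 0} := by
    rw [← measure_univ (μ := P)]
    refine (measure_mono fun ω _ => ?_).trans (measure_union_le _ _)
    exact le_total 0 (W t ω)
  rw [← h1, ← two_mul] at h2
  rw [ENNReal.div_le_iff_le_mul (by simp) (by simp), mul_comm]
  exact h2

/-- By continuity at time `0`, a Brownian motion makes no large excursion in a short time, with a
probability close to one. -/
lemma exists_measure_excursion_le (hW : IsBrownianReal W P) {ε : ℝ} (hε : 0 < ε) {η : ℝ≥0∞}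
    (hη : 0 < η) :
    ∃ m : ℕ, P {ω | ∃ q : ℚ≥0, (q : ℝ≥0) ≤ 1 / (m + 1) ∧ ε < |W q ω|} ≤ η := by
  have hP := hW.isGaussianProcess.isProbabilityMeasure
  let E : ℕ → Set Ω := fun m => {ω | ∃ q : ℚ≥0, (q : ℝ≥0) ≤ 1 / (m + 1) ∧ ε < |W q ω|}
  have hE : ∀ m, NullMeasurableSet (E m) P := fun m => by
    have : E m = ⋃ q : ℚ≥0, ⋃ _ : (q : ℝ≥0) ≤ 1 / (m + 1), {ω | ε < |W q ω|} := by
      ext ω; simp [E]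
    rw [this]
    exact .iUnion fun q => .iUnion fun _ =>
      nullMeasurableSet_lt aemeasurable_const (hW.aemeasurable q).norm
  have hanti : Antitone E := by
    rintro m n hmn ω ⟨q, hq, hω⟩
    refine ⟨q, hq.trans ?_, hω⟩
    gcongr
  have hlim := tendsto_measure_iInter_atTop hE hanti ⟨0, measure_ne_top _ _⟩
  have hnull : P (⋂ m, E m) = 0 := by
    rw [← compl_compl (⋂ m, E m)]
    change ∀ᵐ ω ∂P, ω ∈ (⋂ m, E m)ᶜ
    filter_upwards [hW.tendsto_nhds_zero] with ω hω
    have h1 : ∀ᶠ s in 𝓝 (0 : ℝ≥0), |W s ω| < ε := by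
      have := hω.abs
      rw [abs_zero] at this
      exact this.eventually_lt_const hε
    obtain ⟨u, hu, hsub⟩ := NNReal.nhds_zero_basis.eventually_iff.1 h1
    obtain ⟨m, hm⟩ := exists_nat_one_div_lt hu
    rw [mem_compl_iff, mem_iInter]
    intro H
    obtain ⟨q, hq, hqω⟩ := H m
    exact (hsub (hq.trans_lt hm)).not_gt hqω
  rw [hnull] at hlim
  obtain ⟨m, hm⟩ := (hlim.eventually_le_const hη).exists
  exact ⟨m, hm⟩

/-- From the middle half of `[0,1]`, with a probability bounded below, the path stays in `[0,1]` for
a short time and is in the middle half again at the end of it. -/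
lemma exists_step (hW : IsBrownianReal W P) :
    ∃ m : ℕ, ∀ x ∈ Icc (1 / 4 : ℝ) (3 / 4), 1 / 4 ≤ P {ω |
      (∀ s ≤ (1 / (m + 1) : ℝ≥0), x + W s ω ∈ Icc (0 : ℝ) 1) ∧
        x + W (1 / (m + 1)) ω ∈ Icc (1 / 4 : ℝ) (3 / 4)} := by
  obtain ⟨m, hm⟩ := exists_measure_excursion_le hW (ε := 1 / 4) (by norm_num) (η := 1 / 4)
    (by simp)
  refine ⟨m, fun x hx => ?_⟩
  set δ : ℝ≥0 := 1 / (m + 1)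
  set bad : Set Ω := {ω | ∃ q : ℚ≥0, (q : ℝ≥0) ≤ δ ∧ 1 / 4 < |W q ω|}
  set good : Set Ω := {ω | (∀ s ≤ δ, x + W s ω ∈ Icc (0 : ℝ) 1) ∧
    x + W δ ω ∈ Icc (1 / 4 : ℝ) (3 / 4)}
  -- the increment has the sign that leads towards the centre with probability at least `1/2`
  obtain ⟨A, hA, hAω⟩ : ∃ A : Set Ω, 1 / 2 ≤ P A ∧
      ∀ ω ∈ A, |W δ ω| ≤ 1 / 4 → x + W δ ω ∈ Icc (1 / 4 : ℝ) (3 / 4) := by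
    rcases le_total x (1 / 2) with h | h
    · refine ⟨_, half_le_measure_nonneg hW.toIsPreBrownianReal δ, fun ω hω hb => ?_⟩
      rw [abs_le] at hb
      have hω' : 0 ≤ W δ ω := hω
      constructor <;> linarith [hx.1, hx.2, hb.1, hb.2]
    · refine ⟨_, half_le_measure_nonneg hW.neg.toIsPreBrownianReal δ, fun ω hω hb => ?_⟩
      rw [abs_le] at hb
      have hω' : 0 ≤ -W δ ω := hω
      constructor <;> linarith [hx.1, hx.2, hb.1, hb.2]
  have hsub : A ≤ᵐ[P] (good ∪ bad : Set Ω) := by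
    filter_upwards [hW.cont] with ω hω hωA
    by_cases hb : ω ∈ bad
    · exact Or.inr hb
    · left
      have hb' : ∀ s ≤ δ, W s ω ∈ Icc (-(1 / 4) : ℝ) (1 / 4) := by
        refine forall_mem_of_forall_rat hω isClosed_Icc fun q hq => ?_
        rw [mem_Icc, ← abs_le]
        exact not_lt.1 fun H => hb ⟨q, hq, H⟩
      refine ⟨fun s hs => ?_, hAω ω hωA (abs_le.2 (hb' δ le_rfl))⟩
      have := hb' s hs
      constructor <;> linarith [hx.1, hx.2, this.1, this.2]
  have hle : (1 / 2 : ℝ≥0∞) ≤ P good + 1 / 4 :=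
    hA.trans ((measure_mono_ae hsub).trans ((measure_union_le _ _).trans (by gcongr)))
  have hhalf : (1 / 2 : ℝ≥0∞) = 1 / 4 + 1 / 4 := by
    rw [← ENNReal.toReal_eq_toReal_iff' (by simp) (by simp), ENNReal.toReal_add (by simp) (by simp)]
    norm_num
  rw [hhalf] at hle
  exact (ENNReal.add_le_add_iff_right (by simp)).1 hle

/-- Iterating `exists_step` by the Markov property. The time step is `1 / (m + 1)`. -/
lemma exists_pow_le_meanWeight_zero (hW : IsBrownianReal W P) :
    ∃ m : ℕ, ∀ (n : ℕ), ∀ x ∈ Icc (1 / 4 : ℝ) (3 / 4),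
      (1 / 4) ^ n ≤ meanWeight P W 0 (n * (1 / (m + 1))) x := by
  have hP := hW.isGaussianProcess.isProbabilityMeasure
  obtain ⟨m, hm⟩ := exists_step hW
  refine ⟨m, fun n => ?_⟩
  induction n with
  | zero =>
    intro x hx
    have : ∀ᵐ ω ∂P, pathWeight 0 0 (fun s => x + W s ω) = 1 := by
      filter_upwards [hW.eval_zero_ae_eq_zero] with ω hω
      rw [pathWeight_of_mem]
      · simp
      · intro s hs
        obtain rfl : s = 0 := le_antisymm hs zero_le
        rw [hω]
        constructor <;> linarith [hx.1, hx.2]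
    simp [meanWeight, lintegral_congr_ae this]
  | succ n ih =>
    intro x hx
    have e : ((n + 1 : ℕ) : ℝ≥0) * (1 / (m + 1)) = 1 / (m + 1) + n * (1 / (m + 1)) := by
      push_cast; ring
    rw [e, meanWeight_add hW, pow_succ']
    set good : Set Ω := {ω | (∀ s ≤ (1 / (m + 1) : ℝ≥0), x + W s ω ∈ Icc (0 : ℝ) 1) ∧
        x + W (1 / (m + 1)) ω ∈ Icc (1 / 4 : ℝ) (3 / 4)}
    calc (1 / 4 : ℝ≥0∞) * (1 / 4) ^ n ≤ (1 / 4) ^ n * P good := by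
          rw [mul_comm]; gcongr; exact hm x hx
      _ ≤ _ := by
          -- Markov's inequality for the integrand, which is at least `(1 / 4) ^ n` on `good`
          refine le_trans ?_ (mul_meas_ge_le_lintegral₀
            ((aemeasurable_pathWeight hW 0 (1 / (m + 1)) x).mul
              ((measurable_meanWeight hW 0 _).comp_aemeasurable
                ((hW.aemeasurable (1 / (m + 1))).const_add x))) ((1 / 4) ^ n))
          gcongr
          intro ω hω
          have h1 : pathWeight 0 (1 / (m + 1)) (fun s => x + W s ω) = 1 := by
            rw [pathWeight_of_mem 0 hω.1]
            simp
          change (1 / 4) ^ n ≤ pathWeight 0 (1 / (m + 1)) (fun s => x + W s ω) *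
            meanWeight P W 0 (n * (1 / (m + 1))) (x + W (1 / (m + 1)) ω)
          rw [h1, one_mul]
          exact ih _ hω.2

/-! ### The growth rate -/

/-- The logarithm of `supWeight`, as a real number. -/
noncomputable def logSup (P : Measure Ω) (W : ℝ≥0 → Ω → ℝ) (h : ℝ) (t : ℝ≥0) : ℝ :=
  Real.log (supWeight P W h t).toReal

/-- The exponential lower bound that makes all partition functions positive and their growth rates
finite. -/
lemma exists_le_supWeight_nat (hW : IsBrownianReal W P) :
    ∃ m : ℕ, ∀ (h : ℝ) (n : ℕ),
      ENNReal.ofReal (Real.exp (-|h| * n)) * (1 / 4) ^ (n * (m + 1)) ≤ supWeight P W h n := by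
  obtain ⟨m, hm⟩ := exists_pow_le_meanWeight_zero hW
  refine ⟨m, fun h n => ?_⟩
  have h1 := hm (n * (m + 1)) (1 / 2) (by norm_num)
  have e : ((n * (m + 1) : ℕ) : ℝ≥0) * (1 / (m + 1)) = n := by
    push_cast
    field_simp
  rw [e] at h1
  have h2 := exp_mul_meanWeight_zero_le (P := P) (W := W) h n (1 / 2)
  calc _ ≤ ENNReal.ofReal (Real.exp (-|h| * n)) * meanWeight P W 0 n (1 / 2) := by gcongr
    _ ≤ meanWeight P W h n (1 / 2) := by simpa using h2
    _ ≤ _ := le_iSup (fun y : Icc (0 : ℝ) 1 => meanWeight P W h n y) ⟨1 / 2, by norm_num⟩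

lemma supWeight_pos (hW : IsBrownianReal W P) (h : ℝ) (t : ℝ≥0) : 0 < supWeight P W h t := by
  obtain ⟨m, hm⟩ := exists_le_supWeight_nat hW
  obtain ⟨n, hn⟩ := exists_nat_ge t
  obtain ⟨s, hs⟩ := exists_add_of_le hn
  rw [pos_iff_ne_zero]
  intro h0
  have h1 := supWeight_add_le hW h t s
  rw [← hs, h0, zero_mul] at h1
  have h2 := (hm h n).trans h1
  simp only [nonpos_iff_eq_zero, mul_eq_zero, ENNReal.ofReal_eq_zero, (Real.exp_pos _).not_ge,
    false_or] at h2
  exact pow_ne_zero _ (by simp) h2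

lemma toReal_supWeight_pos (hW : IsBrownianReal W P) (h : ℝ) (t : ℝ≥0) :
    0 < (supWeight P W h t).toReal :=
  have := hW.isGaussianProcess.isProbabilityMeasure
  ENNReal.toReal_pos (supWeight_pos hW h t).ne' (supWeight_ne_top h t)

lemma logSup_add_le (hW : IsBrownianReal W P) (h : ℝ) (s t : ℝ≥0) :
    logSup P W h (s + t) ≤ logSup P W h s + logSup P W h t := by
  have := hW.isGaussianProcess.isProbabilityMeasure
  rw [logSup, logSup, logSup, ← Real.log_mul (toReal_supWeight_pos hW h s).ne'
    (toReal_supWeight_pos hW h t).ne', ← ENNReal.toReal_mul]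
  exact Real.log_le_log (toReal_supWeight_pos hW h _) (ENNReal.toReal_mono
    (ENNReal.mul_ne_top (supWeight_ne_top h s) (supWeight_ne_top h t)) (supWeight_add_le hW h s t))

lemma logSup_le (hW : IsBrownianReal W P) (h : ℝ) (t : ℝ≥0) : logSup P W h t ≤ |h| * t := by
  have := hW.isGaussianProcess.isProbabilityMeasure
  rw [logSup, Real.log_le_iff_le_exp (toReal_supWeight_pos hW h t)]
  exact ENNReal.toReal_le_of_le_ofReal (Real.exp_pos _).le (supWeight_le h t)

lemma exists_mul_le_logSup_nat (hW : IsBrownianReal W P) (h : ℝ) :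
    ∃ c : ℝ, ∀ n : ℕ, c * n ≤ logSup P W h n := by
  have := hW.isGaussianProcess.isProbabilityMeasure
  obtain ⟨m, hm⟩ := exists_le_supWeight_nat hW
  refine ⟨-|h| + (m + 1) * Real.log (1 / 4), fun n => ?_⟩
  rw [logSup, Real.le_log_iff_exp_le (toReal_supWeight_pos hW h n)]
  refine le_trans (le_of_eq ?_) (ENNReal.toReal_mono (supWeight_ne_top h _) (hm h n))
  rw [ENNReal.toReal_mul, ENNReal.toReal_ofReal (Real.exp_pos _).le, ENNReal.toReal_pow,
    show (1 / 4 : ℝ≥0∞).toReal = 1 / 4 by simp, ← Real.exp_log (show (0 : ℝ) < 1 / 4 by norm_num),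
    ← Real.exp_nat_mul, ← Real.exp_add, Real.exp_log (by norm_num)]
  push_cast
  ring_nf

lemma logSup_convexComb_le (hW : IsBrownianReal W P) {a b : ℝ} (ha : 0 ≤ a) (hb : 0 ≤ b)
    (hab : a + b = 1) (h k : ℝ) (t : ℝ≥0) :
    logSup P W (a * h + b * k) t ≤ a * logSup P W h t + b * logSup P W k t := by
  have := hW.isGaussianProcess.isProbabilityMeasure
  have hh := toReal_supWeight_pos hW h t
  have hk := toReal_supWeight_pos hW k t
  rw [logSup, logSup, logSup, ← Real.log_rpow hh, ← Real.log_rpow hk,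
    ← Real.log_mul (Real.rpow_pos_of_pos hh _).ne' (Real.rpow_pos_of_pos hk _).ne',
    ENNReal.toReal_rpow, ENNReal.toReal_rpow, ← ENNReal.toReal_mul]
  exact Real.log_le_log (toReal_supWeight_pos hW _ t) (ENNReal.toReal_mono
    (ENNReal.mul_ne_top (ENNReal.rpow_ne_top_of_nonneg ha (supWeight_ne_top h t))
      (ENNReal.rpow_ne_top_of_nonneg hb (supWeight_ne_top k t)))
    (supWeight_convexComb_le hW ha hb hab h k t))

lemma exists_tendsto_logSup_nat (hW : IsBrownianReal W P) (h : ℝ) :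
    ∃ L : ℝ, Tendsto (fun n : ℕ => logSup P W h n / n) atTop (𝓝 L) := by
  have hsub : Subadditive fun n : ℕ => logSup P W h n := fun m n => by
    simpa using logSup_add_le hW h m n
  obtain ⟨c, hc⟩ := exists_mul_le_logSup_nat hW h
  refine ⟨hsub.lim, hsub.tendsto_lim ⟨min c 0, ?_⟩⟩
  rintro _ ⟨n, rfl⟩
  rcases Nat.eq_zero_or_pos n with rfl | hn
  · simp
  · have hn' : (0 : ℝ) < n := by exact_mod_cast hn
    exact (min_le_left _ _).trans ((le_div_iff₀ hn').2 (hc n))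

/-- Fekete's lemma gives the limit along the integers. Since `logSup` grows by at most `|h|` over a
time at most `1`, the value at `t` is squeezed between those at `⌊t⌋` and `⌊t⌋ + 1`. -/
lemma exists_tendsto_logSup (hW : IsBrownianReal W P) (h : ℝ) :
    ∃ L : ℝ, Tendsto (fun t : ℝ≥0 => 1 / (t : ℝ) * logSup P W h t) atTop (𝓝 L) := by
  obtain ⟨L, hL⟩ := exists_tendsto_logSup_nat hW h
  refine ⟨L, ?_⟩
  have hcoe : Tendsto (fun t : ℝ≥0 => (t : ℝ)) atTop atTop := NNReal.tendsto_coe_atTop.2 tendsto_id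
  have hfloor : Tendsto (fun t : ℝ≥0 => ⌊(t : ℝ)⌋₊) atTop atTop := tendsto_nat_floor_atTop.comp hcoe
  have hinv : Tendsto (fun t : ℝ≥0 => (t : ℝ)⁻¹) atTop (𝓝 0) := tendsto_inv_atTop_zero.comp hcoe
  have hratio : Tendsto (fun t : ℝ≥0 => (⌊(t : ℝ)⌋₊ : ℝ) / t) atTop (𝓝 1) :=
    (tendsto_nat_floor_div_atTop (R := ℝ)).comp hcoe
  have hpos : ∀ᶠ t : ℝ≥0 in atTop, 0 < (t : ℝ) := hcoe.eventually_gt_atTop 0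
  have hlow : Tendsto (fun t : ℝ≥0 => logSup P W h ((⌊(t : ℝ)⌋₊ + 1 : ℕ) : ℝ≥0) /
      ((⌊(t : ℝ)⌋₊ + 1 : ℕ) : ℝ) * ((⌊(t : ℝ)⌋₊ : ℝ) / t + (t : ℝ)⁻¹) - |h| * (t : ℝ)⁻¹)
      atTop (𝓝 L) := by
    have h1 := (hL.comp (tendsto_add_atTop_nat 1)).comp hfloor
    simpa using (h1.mul (hratio.add hinv)).sub (hinv.const_mul |h|)
  have hup : Tendsto (fun t : ℝ≥0 => logSup P W h (⌊(t : ℝ)⌋₊ : ℝ≥0) / (⌊(t : ℝ)⌋₊ : ℝ) *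
      ((⌊(t : ℝ)⌋₊ : ℝ) / t) + |h| * (t : ℝ)⁻¹) atTop (𝓝 L) := by
    simpa using ((hL.comp hfloor).mul hratio).add (hinv.const_mul |h|)
  refine tendsto_of_tendsto_of_tendsto_of_le_of_le' hlow hup ?_ ?_
  · filter_upwards [hpos] with t ht
    have hlt : t ≤ ((⌊(t : ℝ)⌋₊ + 1 : ℕ) : ℝ≥0) := by
      rw [← NNReal.coe_le_coe]
      exact_mod_cast (Nat.lt_floor_add_one (t : ℝ)).le
    obtain ⟨s, hs⟩ := exists_add_of_le hlt
    have hs1 : (s : ℝ) ≤ 1 := by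
      have h1 : ((⌊(t : ℝ)⌋₊ : ℝ) + 1) = t + s := by exact_mod_cast congrArg NNReal.toReal hs
      linarith [Nat.floor_le ht.le]
    have h2 := logSup_add_le hW h t s
    rw [← hs] at h2
    have h3 : logSup P W h s ≤ |h| :=
      (logSup_le hW h s).trans (mul_le_of_le_one_right (abs_nonneg h) hs1)
    have h4 : logSup P W h ((⌊(t : ℝ)⌋₊ + 1 : ℕ) : ℝ≥0) / ((⌊(t : ℝ)⌋₊ + 1 : ℕ) : ℝ) *
        ((⌊(t : ℝ)⌋₊ : ℝ) / t + (t : ℝ)⁻¹) - |h| * (t : ℝ)⁻¹ =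
        1 / t * (logSup P W h ((⌊(t : ℝ)⌋₊ + 1 : ℕ) : ℝ≥0) - |h|) := by
      push_cast
      field_simp
    rw [h4]
    exact mul_le_mul_of_nonneg_left (by linarith) (by positivity)
  · filter_upwards [hcoe.eventually_ge_atTop 1] with t ht1
    have ht : (0 : ℝ) < t := by linarith
    have hfl : ((⌊(t : ℝ)⌋₊ : ℕ) : ℝ≥0) ≤ t := by
      rw [← NNReal.coe_le_coe]
      exact_mod_cast Nat.floor_le ht.le
    obtain ⟨s, hs⟩ := exists_add_of_le hfl
    have hs1 : (s : ℝ) ≤ 1 := by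
      have h1 : (t : ℝ) = ⌊(t : ℝ)⌋₊ + s := by exact_mod_cast congrArg NNReal.toReal hs
      linarith [Nat.lt_floor_add_one (t : ℝ)]
    have h2 := logSup_add_le hW h (⌊(t : ℝ)⌋₊ : ℝ≥0) s
    rw [← hs] at h2
    have h3 : logSup P W h s ≤ |h| :=
      (logSup_le hW h s).trans (mul_le_of_le_one_right (abs_nonneg h) hs1)
    have hne : (⌊(t : ℝ)⌋₊ : ℝ) ≠ 0 := by
      exact_mod_cast (Nat.floor_pos.2 ht1).ne'
    have h4 : logSup P W h (⌊(t : ℝ)⌋₊ : ℝ≥0) / (⌊(t : ℝ)⌋₊ : ℝ) * ((⌊(t : ℝ)⌋₊ : ℝ) / t) +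
        |h| * (t : ℝ)⁻¹ = 1 / t * (logSup P W h (⌊(t : ℝ)⌋₊ : ℝ≥0) + |h|) := by
      field_simp
    rw [h4]
    exact mul_le_mul_of_nonneg_left (by linarith) (by positivity)

lemma exists_convex_rate (hW : IsBrownianReal W P) :
    ∃ Ψ : ℝ → ℝ, ConvexOn ℝ univ Ψ ∧
      ∀ h, Tendsto (fun t : ℝ≥0 => 1 / (t : ℝ) * logSup P W h t) atTop (𝓝 (Ψ h)) := by
  choose Ψ hΨ using exists_tendsto_logSup hW
  refine ⟨Ψ, ⟨convex_univ, fun h _ k _ a b ha hb hab => ?_⟩, hΨ⟩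
  refine le_of_tendsto_of_tendsto' (hΨ (a • h + b • k))
    (((hΨ h).const_mul a).add ((hΨ k).const_mul b)) fun t => ?_
  have h1 : 1 / (t : ℝ) * logSup P W (a * h + b * k) t ≤
      1 / t * (a * logSup P W h t + b * logSup P W k t) :=
    mul_le_mul_of_nonneg_left (logSup_convexComb_le hW ha hb hab h k t) (by positivity)
  calc _ ≤ _ := h1
    _ = _ := by ring

/-! ### Brownian families -/

lemma confinedLaplace_eq {B : ℝ≥0 → Ω → ℝ} {x : ℝ} (hB : IsBrownianReal (fun t ω => B t ω - x) P)
    (h : ℝ) (t : ℝ≥0) :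
    confinedLaplace P B h t = (meanWeight P (fun t ω => B t ω - x) h t x).toReal := by
  have hP := hB.isGaussianProcess.isProbabilityMeasure
  have hrat : AEMeasurable (fun ω (q : ℚ≥0) => B q ω) P :=
    aemeasurable_pi_lambda _ fun q => by simpa using (hB.aemeasurable q).add_const x
  have hcont : ∀ᵐ ω ∂P, Continuous fun s => B s ω := by
    filter_upwards [hB.cont] with ω hω
    simpa using hω.add_const x
  set S : Set Ω := {ω | ∀ s : ℝ≥0, s ≤ t → B s ω ∈ Icc (0 : ℝ) 1}
  have hS : NullMeasurableSet S P := by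
    have h1 : NullMeasurableSet {ω | ∀ q : ℚ≥0, (q : ℝ≥0) ≤ t → B q ω ∈ Icc (0 : ℝ) 1} P := by
      simp only [ofPred_forall]
      refine .iInter fun q => .iInter fun _ => ?_
      exact (aemeasurable_pi_iff.1 hrat q).nullMeasurable measurableSet_Icc
    refine h1.congr ?_
    filter_upwards [hcont] with ω hω
    exact propext ⟨fun H => forall_mem_of_forall_rat hω isClosed_Icc H, fun H q hq => H _ hq⟩
  have hf : AEStronglyMeasurable
      (fun ω => Real.exp (-h * ∫ s in (0 : ℝ)..(t : ℝ), B s.toNNReal ω)) P := by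
    have h1 : AEMeasurable (fun ω => Real.exp (-h * ratArea t fun q => B q ω)) P :=
      (((measurable_ratArea t).comp_aemeasurable hrat).const_mul (-h)).exp
    refine (h1.congr ?_).aestronglyMeasurable
    filter_upwards [hcont] with ω hω
    rw [ratArea_of_continuous hω]
  rw [confinedLaplace, integral_eq_lintegral_of_nonneg_ae (.of_forall fun ω => (Real.exp_pos _).le)
    hf.restrict, ← lintegral_indicator₀ hS, meanWeight]
  congr 1
  refine lintegral_congr fun ω => ?_
  simp only [add_sub_cancel]
  by_cases hω : ω ∈ S
  · rw [indicator_of_mem hω, pathWeight_of_mem h hω]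
  · rw [indicator_of_notMem hω, pathWeight]
    exact (if_neg hω).symm

/-- A Brownian family `(Q, B)` has the partition function of any one Brownian motion `W` started
from `0`, on whatever probability space `W` lives. -/
lemma log_iSup_confinedLaplace_eq (hW : IsBrownianReal W P) {Q : ℝ → Measure Ω'}
    {B : ℝ≥0 → Ω' → ℝ} (hB : IsBrownianFamily Q B) (h : ℝ) (t : ℝ≥0) :
    Real.log (⨆ x : Icc (0 : ℝ) 1, confinedLaplace (Q x) B h t) = logSup P W h t := by
  have hP := hW.isGaussianProcess.isProbabilityMeasure
  rw [logSup, supWeight, ENNReal.toReal_iSup fun x : Icc (0 : ℝ) 1 =>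
    ((meanWeight_le (P := P) (W := W) h t x).trans_lt ENNReal.ofReal_lt_top).ne]
  congr 2
  ext x
  rw [confinedLaplace_eq (hB x), meanWeight_eq (hB x) hW]

end ConfinedBrownian

open ConfinedBrownian in
theorem lemma1p3 :
    ∃ Ψ : ℝ → ℝ, ConvexOn ℝ Set.univ Ψ ∧
      ∀ (Ω : Type*) [MeasurableSpace Ω] (P : ℝ → Measure Ω) (B : ℝ≥0 → Ω → ℝ),
        IsBrownianFamily P B →
          IsConfinedRate P B Ψ ∧
            ∀ Φ : ℝ → ℝ, ConvexOn ℝ Set.univ Φ → IsConfinedRate P B Φ → Φ = Ψ := by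
  -- `Ψ` is the rate of one Brownian motion `W`, and every Brownian family has the same rate as `W`.
  -- The case distinction replaces a construction of Brownian motion: any Brownian family provides
  -- such a `W`, and the second case claims nothing about an actual family.
  by_cases hex : ∃ (Ω : Type _) (_ : MeasurableSpace Ω) (P : Measure Ω) (W : ℝ≥0 → Ω → ℝ),
      IsBrownianReal W P
  · obtain ⟨Ω₀, _, P₀, W, hW⟩ := hex
    obtain ⟨Ψ, hconv, hΨ⟩ := exists_convex_rate hW
    refine ⟨Ψ, hconv, fun Ω _ P B hB => ?_⟩
    have hrate : IsConfinedRate P B Ψ := fun h =>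
      (hΨ h).congr fun t => by rw [log_iSup_confinedLaplace_eq hW hB]
    exact ⟨hrate, fun Φ _ hΦ => funext fun h => tendsto_nhds_unique (hΦ h) (hrate h)⟩
  · exact ⟨fun _ => 0, convexOn_const 0 convex_univ,
      fun Ω _ P B hB => (hex ⟨Ω, inferInstance, P 0, _, hB 0⟩).elim⟩
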